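/- Let $G$ be a finite simple graph on $n$ vertices with adjacency matrix $A(G)$. For $1\le k\le n$, the $k$-th characteristic ideal $A_k(G,t)\subseteq\mathbb{Z}[t]$ is the ideal generated by all $k\times k$ minors of $tI_n-A(G)$; it is called trivial if it equals $\mathbb{Z}[t]$. Let $\mathcal{C}_{\le 3}$ be the family of graphs for which at most three of the ideals $A_1(G,t),\dots,A_n(G,t)$ are trivial. For a graph $H=(V,E)$ and a vector $\mathbf{d}\in\mathbb{Z}^V$, let $H^{\mathbf{d}}$ be the graph obtained by replacing each vertex $u$ of $H$ by a set $V_u$ of $|\mathbf{d}_u|$ vertices, which is a clique if $\mathbf{d}_u<0$ and a stable set if $\mathbf{d}_u>0$, and, for $u\ne v$, joining every vertex of $V_u$ to every vertex of $V_v$ if $u$ and $v$ are adjacent in $H$ (and to none otherwise). Let $C_n$ be the cycle on $n$ vertices, $K_n$ the complete graph on $n$ vertices, $S_4$ the star with four vertices (one apex and three leaves), and $\Box$ the Cartesian product of graphs. **Theorem.** A connected finite simple graph $G$ is in $\mathcal{C}_{\le 3}$ if and only if it is (isomorphic to) an induced subgraph of one of the following: 1. $C_5$; 2. the triangular prism $K_3\,\Box\,K_2$;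 3. a complete $4$-partite graph (with four nonempty finite parts); 4. $C_4^{\mathbf{r}}$ for some $\mathbf{r}\in\mathbb{Z}^4$ with all entries negative; 5. $S_4^{\mathbf{r}}$ for some $\mathbf{r}\in\mathbb{Z}^4$ with all entries negative. -/

import Mathlib

open Polynomial

/-- The `k`-th determinantal ideal of a matrix: the ideal generated by all its `k`-minors, i.e. by
the determinants of the submatrices with `k` distinct rows and `k` distinct columns. The rows and
columns are selected by injections from `Fin k`; the order in which they are listed changes a minor
only by a sign (see `determinantalIdeal_eq_span_orderEmbedding`). -/
def determinantalIdeal {m n R : Type*} [CommRing R] (M : Matrix m n R) (k : ℕ) : Ideal R :=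
  Ideal.span {p : R | ∃ (r : Fin k ↪ m) (c : Fin k ↪ n), p = (M.submatrix r c).det}

/-- Every injection of `Fin k` into a linear order is an increasing one up to a permutation. -/
theorem exists_orderEmbedding_comp_perm {l : Type*} [LinearOrder l] {k : ℕ} (r : Fin k ↪ l) :
    ∃ (r' : Fin k ↪o l) (σ : Equiv.Perm (Fin k)), ∀ i, r i = r' (σ i) := by
  have hcard : (Finset.univ.map r).card = k := by simp
  let e := (Finset.univ.map r).orderIsoOfFin hcard
  have hmem : ∀ i, r i ∈ Finset.univ.map r := fun i => by simp
  have hinj : Function.Injective (fun i => e.symm ⟨r i, hmem i⟩) := by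
    intro i j hij
    have := e.symm.injective hij
    exact r.injective (congrArg Subtype.val this)
  refine ⟨(Finset.univ.map r).orderEmbOfFin hcard,
    Equiv.ofBijective _ (Finite.injective_iff_bijective.mp hinj), fun i => ?_⟩
  have h : (e (e.symm ⟨r i, hmem i⟩) : l) = r i := by simp
  exact h.symm

/-- For linearly ordered index sets, the determinantal ideal is generated by the minors whose rows
and columns are listed in strictly increasing order. -/
theorem determinantalIdeal_eq_span_orderEmbedding {m n R : Type*} [LinearOrder m] [LinearOrder n]
    [CommRing R] (M : Matrix m n R) (k : ℕ) :
    determinantalIdeal M k =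
      Ideal.span {p : R | ∃ (r : Fin k ↪o m) (c : Fin k ↪o n), p = (M.submatrix r c).det} := by
  apply le_antisymm
  · refine Ideal.span_le.mpr ?_
    rintro p ⟨r, c, rfl⟩
    obtain ⟨r', σ, hr⟩ := exists_orderEmbedding_comp_perm r
    obtain ⟨c', τ, hc⟩ := exists_orderEmbedding_comp_perm c
    have h : M.submatrix r c = ((M.submatrix r' c').submatrix σ id).submatrix id τ := by
      ext i j
      simp [hr, hc]
    rw [h, Matrix.det_permute', Matrix.det_permute]
    exact Ideal.mul_mem_left _ _ (Ideal.mul_mem_left _ _ (Ideal.subset_span ⟨r', c', rfl⟩))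
  · refine Ideal.span_mono ?_
    rintro p ⟨r, c, rfl⟩
    exact ⟨r.toEmbedding, c.toEmbedding, rfl⟩

namespace SimpleGraph

/-- The `k`-th characteristic ideal of a finite graph `G`: the `k`-th determinantal ideal of
`t I - A(G)` over `ℤ[t]`. (`Matrix.charmatrix A` is the matrix `t I - A`.) -/
noncomputable def characteristicIdeal {V : Type*} [Fintype V] [DecidableEq V] (G : SimpleGraph V)
    [DecidableRel G.Adj] (k : ℕ) : Ideal ℤ[X] :=
  determinantalIdeal (Matrix.charmatrix (G.adjMatrix ℤ)) k

/-- The number of indices `k` with `1 ≤ k ≤ |V|` for which the `k`-th characteristic ideal is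
trivial, i.e. equal to the whole ring `ℤ[t]`. -/
noncomputable def numTrivialCharacteristicIdeals {V : Type*} [Fintype V] [DecidableEq V]
    (G : SimpleGraph V) [DecidableRel G.Adj] : ℕ :=
  {k : ℕ | 1 ≤ k ∧ k ≤ Fintype.card V ∧ G.characteristicIdeal k = ⊤}.ncard

/-- The graph `G^d`, for `d ∈ ℤ^V`: every vertex `u` of `G` is replaced by a set `V_u` of `|d u|`
vertices, which is a clique if `d u` is negative and a stable set if `d u` is positive; for `u ≠ v`
every vertex of `V_u` is adjacent to every vertex of `V_v` if `u` and `v` are adjacent in `G`, and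
to none of them otherwise. -/
def blowup {V : Type*} (G : SimpleGraph V) (d : V → ℤ) :
    SimpleGraph (Σ u : V, Fin (d u).natAbs) where
  Adj x y := G.Adj x.1 y.1 ∨ (x.1 = y.1 ∧ d x.1 < 0 ∧ x ≠ y)
  symm := ⟨fun _ _ h =>
    h.elim (fun h => Or.inl h.symm) fun h => Or.inr ⟨h.1.symm, h.1 ▸ h.2.1, h.2.2.symm⟩⟩
  loopless := ⟨fun _ h => h.elim (fun h => h.ne rfl) fun h => h.2.2 rfl⟩

end SimpleGraph

set_option linter.unusedSimpArgs false

/-! The characteristic ideals decrease with `k`, so the condition says that the fourth one is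
proper, i.e. lies in a maximal ideal. Equivalently, over some field `F` and for some `τ` in `F`, all
4-minors of `τI - A(G)` vanish: this matrix has rank at most 3 (`exists_minorsVanish`,
`characteristicIdeal_ne_top_of_factors`).

For each of the five families a rank-3 factorization is exhibited over a field with 2, 3 or 5
elements; twins with equal rows (nonadjacent at `τ = 0`, adjacent at `τ = -1`) reduce the infinite
families to 4 × 4 matrices.

Conversely, let the 4-minors vanish. If `G` contains an induced path on four vertices, the minors
leave room for at most two further vertices, attached in prescribed ways, and `G` lies in `C_5` or
the prism (`IsInducedPath.isIndContained`). Otherwise, if `τ = -1`, an induced path on three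
vertices carries a minor equal to 1, so it determines the whole matrix, and `G` is a clique blow-up
inside that of a star (characteristic 2) or of `C_4` (`isIndContained_of_minorsVanish_neg_one`). If
`τ ≠ -1`, then `K_5` is excluded, so a complete multipartite `G` has at most four parts; any other
`G` contains a paw, and the minors force `G` to be that paw. -/

/-- All `4`-minors of a square array vanish; repeated rows and columns are allowed, since they only
contribute zero determinants. -/
def MinorsVanish {V F : Type*} [CommRing F] (w : V → V → F) : Prop :=
  ∀ a b c d a' b' c' d' : V,
    w a a' * (w b b' * (w c c' * w d d' - w c d' * w d c') -
      w b c' * (w c b' * w d d' - w c d' * w d b') + w b d' * (w c b' * w d c' - w c c' * w d b')) -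
    w a b' * (w b a' * (w c c' * w d d' - w c d' * w d c') -
      w b c' * (w c a' * w d d' - w c d' * w d a') + w b d' * (w c a' * w d c' - w c c' * w d a')) +
    w a c' * (w b a' * (w c b' * w d d' - w c d' * w d b') -
      w b b' * (w c a' * w d d' - w c d' * w d a') + w b d' * (w c a' * w d b' - w c b' * w d a')) -
    w a d' * (w b a' * (w c b' * w d c' - w c c' * w d b') -
      w b b' * (w c a' * w d c' - w c c' * w d a') + w b c' * (w c a' * w d b' - w c b' * w d a')) = 0

theorem minorsVanish_iff {V F : Type*} [CommRing F] (w : V → V → F) :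
    MinorsVanish w ↔ ∀ r c : Fin 4 → V, ((Matrix.of w).submatrix r c).det = 0 := by
  have key : ∀ r c : Fin 4 → V, ((Matrix.of w).submatrix r c).det =
    w (r 0) (c 0) * (w (r 1) (c 1) * (w (r 2) (c 2) * w (r 3) (c 3) -
        w (r 2) (c 3) * w (r 3) (c 2)) -
      w (r 1) (c 2) * (w (r 2) (c 1) * w (r 3) (c 3) - w (r 2) (c 3) * w (r 3) (c 1)) +
        w (r 1) (c 3) * (w (r 2) (c 1) * w (r 3) (c 2) - w (r 2) (c 2) * w (r 3) (c 1))) -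
    w (r 0) (c 1) * (w (r 1) (c 0) * (w (r 2) (c 2) * w (r 3) (c 3) -
        w (r 2) (c 3) * w (r 3) (c 2)) -
      w (r 1) (c 2) * (w (r 2) (c 0) * w (r 3) (c 3) - w (r 2) (c 3) * w (r 3) (c 0)) +
        w (r 1) (c 3) * (w (r 2) (c 0) * w (r 3) (c 2) - w (r 2) (c 2) * w (r 3) (c 0))) +
    w (r 0) (c 2) * (w (r 1) (c 0) * (w (r 2) (c 1) * w (r 3) (c 3) -
        w (r 2) (c 3) * w (r 3) (c 1)) -
      w (r 1) (c 1) * (w (r 2) (c 0) * w (r 3) (c 3) - w (r 2) (c 3) * w (r 3) (c 0)) +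
        w (r 1) (c 3) * (w (r 2) (c 0) * w (r 3) (c 1) - w (r 2) (c 1) * w (r 3) (c 0))) -
    w (r 0) (c 3) * (w (r 1) (c 0) * (w (r 2) (c 1) * w (r 3) (c 2) -
        w (r 2) (c 2) * w (r 3) (c 1)) -
      w (r 1) (c 1) * (w (r 2) (c 0) * w (r 3) (c 2) - w (r 2) (c 2) * w (r 3) (c 0)) +
        w (r 1) (c 2) * (w (r 2) (c 0) * w (r 3) (c 1) - w (r 2) (c 1) * w (r 3) (c 0))) := by
    intro r c
    rw [Matrix.det_succ_row_zero]
    simp only [Fin.sum_univ_four, Matrix.det_fin_three, Matrix.submatrix_apply, Matrix.of_apply,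
      Fin.succAbove, Fin.succ, Fin.castSucc, Fin.lt_def]
    simp [Fin.castAdd, Fin.castLE]
    ring
  constructor
  · intro h r c
    rw [key]
    exact h _ _ _ _ _ _ _ _
  · intro h a b c d a' b' c' d'
    have := h ![a, b, c, d] ![a', b', c', d']
    rw [key] at this
    exact this

/-! ### Minor certificates for vertices outside an induced path or paw -/

section
variable {V F : Type*} [Field F]

theorem of_one_eq_zero (F : Type*) [Field F] {P : Prop} (h : (1 : F) = 0) : P :=
  absurd h one_ne_zero

/-- Each of the 13 excluded adjacency patterns makes one or two minors, as polynomials in `τ`,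
generate the unit ideal of `ℤ[τ]`; the coefficients in `linear_combination` are Bézout certificates,
valid in every characteristic. The survivors complete the path to a 5-cycle or to a house. -/
theorem path_neighbor_types {w : V → V → F} {τ : F} (D : MinorsVanish w)
    (hs : ∀ u v, w u v = w v u) (hd : ∀ v, w v v = τ) {p₀ p₁ p₂ p₃ x : V}
    (h₀₁ : w p₀ p₁ = -1) (h₀₂ : w p₀ p₂ = 0) (h₀₃ : w p₀ p₃ = 0)
    (h₁₂ : w p₁ p₂ = -1) (h₁₃ : w p₁ p₃ = 0) (h₂₃ : w p₂ p₃ = -1)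
    (c₀ : w p₀ x = 0 ∨ w p₀ x = -1) (c₁ : w p₁ x = 0 ∨ w p₁ x = -1)
    (c₂ : w p₂ x = 0 ∨ w p₂ x = -1) (c₃ : w p₃ x = 0 ∨ w p₃ x = -1) :
    (w p₀ x = -1 ∧ w p₁ x = 0 ∧ w p₂ x = 0 ∧ w p₃ x = -1) ∨
    (w p₀ x = -1 ∧ w p₁ x = -1 ∧ w p₂ x = 0 ∧ w p₃ x = -1) ∨
    (w p₀ x = -1 ∧ w p₁ x = 0 ∧ w p₂ x = -1 ∧ w p₃ x = -1) := by
  have h₁₀ : w p₁ p₀ = -1 := by rw [hs, h₀₁]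
  have h₂₀ : w p₂ p₀ = 0 := by rw [hs, h₀₂]
  have h₃₀ : w p₃ p₀ = 0 := by rw [hs, h₀₃]
  have h₂₁ : w p₂ p₁ = -1 := by rw [hs, h₁₂]
  have h₃₁ : w p₃ p₁ = 0 := by rw [hs, h₁₃]
  have h₃₂ : w p₃ p₂ = -1 := by rw [hs, h₂₃]
  have s₀ := hs x p₀
  have s₁ := hs x p₁
  have s₂ := hs x p₂
  have s₃ := hs x p₃
  clear hs
  rcases c₀ with c₀ | c₀ <;> rcases c₁ with c₁ | c₁ <;> rcases c₂ with c₂ | c₂ <;>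
    rcases c₃ with c₃ | c₃ <;> rw [c₀] at s₀ <;> rw [c₁] at s₁ <;> rw [c₂] at s₂ <;>
    rw [c₃] at s₃
  · have h₁ := D p₀ p₁ p₂ x p₁ p₂ p₃ x
    have h₂ := D p₀ p₁ p₂ p₃ p₀ p₁ p₂ p₃
    simp only [*] at h₁ h₂
    exact of_one_eq_zero F (by linear_combination ((-3) * τ + τ ^ 3) * h₁ + h₂)
  · have h₁ := D p₀ p₁ p₂ p₃ p₁ p₂ p₃ x
    simp only [*] at h₁
    exact of_one_eq_zero F (by linear_combination h₁)
  · have h₁ := D p₀ p₁ p₂ p₃ p₁ p₂ p₃ x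
    have h₂ := D p₀ p₁ p₂ p₃ p₀ p₁ p₂ x
    simp only [*] at h₁ h₂
    exact of_one_eq_zero F (by linear_combination τ * h₁ + h₂)
  · have h₁ := D p₀ p₁ p₂ p₃ p₁ p₂ p₃ x
    have h₂ := D p₀ p₁ p₂ p₃ p₀ p₁ p₂ x
    simp only [*] at h₁ h₂
    exact of_one_eq_zero F (by linear_combination (2 - τ ^ 2) * h₁ - h₂)
  · have h₁ := D p₀ p₁ p₂ p₃ p₀ p₁ p₂ x
    have h₂ := D p₀ p₁ p₂ p₃ p₁ p₂ p₃ x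
    simp only [*] at h₁ h₂
    exact of_one_eq_zero F (by linear_combination -τ * h₁ - h₂)
  · have h₁ := D p₀ p₁ p₂ x p₁ p₂ p₃ x
    have h₂ := D p₀ p₁ p₂ p₃ p₀ p₁ p₃ x
    simp only [*] at h₁ h₂
    exact of_one_eq_zero F (by linear_combination ((-2) * τ ^ 3) * h₁ + ((-1) + (-2) * τ ^ 2) * h₂)
  · have h₁ := D p₀ p₁ p₂ x p₁ p₂ p₃ x
    have h₂ := D p₀ p₁ p₂ p₃ p₀ p₁ p₂ x
    simp only [*] at h₁ h₂
    exact of_one_eq_zero F (by linear_combination -τ * h₁ + h₂)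
  · have h₁ := D p₀ p₁ p₂ p₃ p₁ p₂ p₃ x
    have h₂ := D p₀ p₁ p₂ p₃ p₀ p₁ p₃ x
    simp only [*] at h₁ h₂
    exact of_one_eq_zero F (by
      linear_combination ((-3) + 3 * τ + 2 * τ ^ 2) * h₁ + ((-1) + (-2) * τ) * h₂)
  · have h₁ := D p₀ p₁ p₂ p₃ p₀ p₁ p₂ x
    simp only [*] at h₁
    exact of_one_eq_zero F (by linear_combination -h₁)
  · exact Or.inl ⟨c₀, c₁, c₂, c₃⟩
  · have h₁ := D p₀ p₁ p₂ x p₁ p₂ p₃ x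
    have h₂ := D p₀ p₁ p₂ p₃ p₀ p₂ p₃ x
    simp only [*] at h₁ h₂
    exact of_one_eq_zero F (by linear_combination ((-2) * τ ^ 3) * h₁ + (1 + 2 * τ ^ 2) * h₂)
  · exact Or.inr (Or.inr ⟨c₀, c₁, c₂, c₃⟩)
  · have h₁ := D p₀ p₁ p₂ p₃ p₀ p₁ p₂ x
    have h₂ := D p₀ p₁ p₂ p₃ p₁ p₂ p₃ x
    simp only [*] at h₁ h₂
    exact of_one_eq_zero F (by linear_combination ((-2) + τ ^ 2) * h₁ + h₂)
  · exact Or.inr (Or.inl ⟨c₀, c₁, c₂, c₃⟩)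
  · have h₁ := D p₀ p₁ p₂ p₃ p₀ p₁ p₂ x
    have h₂ := D p₀ p₁ p₂ p₃ p₀ p₂ p₃ x
    simp only [*] at h₁ h₂
    exact of_one_eq_zero F (by
      linear_combination (3 + (-3) * τ + (-2) * τ ^ 2) * h₁ + (1 + 2 * τ) * h₂)
  · have h₁ := D p₀ p₁ p₂ x p₀ p₂ p₃ x
    have h₂ := D p₀ p₁ p₃ x p₀ p₂ p₃ x
    simp only [*] at h₁ h₂
    exact of_one_eq_zero F (by
      linear_combination (1 + τ + 3 * τ ^ 3) * h₁ + ((-1) + 3 * τ + 6 * τ ^ 2) * h₂)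

/-- Here `p₀ p₁ p₂` is the triangle and `p₃` the pendant vertex at `p₀`. The method is that for
paths, except that some patterns only put `τ + 1` or its square into the ideal of minors. Both
surviving patterns create an induced path on four vertices. -/
theorem paw_neighbor_types {w : V → V → F} {τ : F} (D : MinorsVanish w)
    (hs : ∀ u v, w u v = w v u) (hd : ∀ v, w v v = τ) {p₀ p₁ p₂ p₃ x : V}
    (h₀₁ : w p₀ p₁ = -1) (h₀₂ : w p₀ p₂ = -1) (h₀₃ : w p₀ p₃ = -1)
    (h₁₂ : w p₁ p₂ = -1) (h₁₃ : w p₁ p₃ = 0) (h₂₃ : w p₂ p₃ = 0)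
    (c₀ : w p₀ x = 0 ∨ w p₀ x = -1) (c₁ : w p₁ x = 0 ∨ w p₁ x = -1)
    (c₂ : w p₂ x = 0 ∨ w p₂ x = -1) (c₃ : w p₃ x = 0 ∨ w p₃ x = -1) :
    τ = -1 ∨
    (w p₀ x = 0 ∧ w p₁ x = -1 ∧ w p₂ x = 0 ∧ w p₃ x = -1) ∨
    (w p₀ x = 0 ∧ w p₁ x = 0 ∧ w p₂ x = -1 ∧ w p₃ x = -1) := by
  have h₁₀ : w p₁ p₀ = -1 := by rw [hs, h₀₁]
  have h₂₀ : w p₂ p₀ = -1 := by rw [hs, h₀₂]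
  have h₃₀ : w p₃ p₀ = -1 := by rw [hs, h₀₃]
  have h₂₁ : w p₂ p₁ = -1 := by rw [hs, h₁₂]
  have h₃₁ : w p₃ p₁ = 0 := by rw [hs, h₁₃]
  have h₃₂ : w p₃ p₂ = 0 := by rw [hs, h₂₃]
  have s₀ := hs x p₀
  have s₁ := hs x p₁
  have s₂ := hs x p₂
  have s₃ := hs x p₃
  clear hs
  rcases c₀ with c₀ | c₀ <;> rcases c₁ with c₁ | c₁ <;> rcases c₂ with c₂ | c₂ <;>
    rcases c₃ with c₃ | c₃ <;> rw [c₀] at s₀ <;> rw [c₁] at s₁ <;> rw [c₂] at s₂ <;>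
    rw [c₃] at s₃
  · have h₁ := D p₀ p₁ p₃ x p₀ p₂ p₃ x
    have h₂ := D p₀ p₁ p₂ p₃ p₀ p₁ p₂ p₃
    simp only [*] at h₁ h₂
    exact of_one_eq_zero F (by
      linear_combination (4 + 5 * τ + (-1) * τ ^ 2 + (-1) * τ ^ 3) * h₁ + (1 + (-2) * τ + (-1) * τ ^ 2) * h₂)
  · have h₁ := D p₀ p₁ p₂ p₃ p₀ p₁ p₃ x
    have h₂ := D p₀ p₁ p₃ x p₀ p₂ p₃ x
    simp only [*] at h₁ h₂
    exact of_one_eq_zero F (by linear_combination (2 - τ ^ 2) * h₁ - h₂)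
  · have h₁ := D p₀ p₁ p₂ p₃ p₀ p₁ p₂ x
    have h₂ := D p₀ p₁ p₂ p₃ p₀ p₂ p₃ x
    simp only [*] at h₁ h₂
    exact of_one_eq_zero F (by linear_combination -τ * h₁ + h₂)
  · exact Or.inr (Or.inr ⟨c₀, c₁, c₂, c₃⟩)
  · have h₁ := D p₀ p₁ p₂ p₃ p₀ p₁ p₂ x
    have h₂ := D p₀ p₁ p₂ p₃ p₀ p₁ p₃ x
    simp only [*] at h₁ h₂
    exact of_one_eq_zero F (by linear_combination -τ * h₁ - h₂)
  · exact Or.inr (Or.inl ⟨c₀, c₁, c₂, c₃⟩)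
  · have h₁ := D p₀ p₁ p₂ x p₀ p₁ p₃ x
    have h₂ := D p₀ p₁ p₃ x p₀ p₂ p₃ x
    simp only [*] at h₁ h₂
    exact of_one_eq_zero F (by
      linear_combination (3 + (-3) * τ + (-2) * τ ^ 2) * h₁ + (1 + 2 * τ) * h₂)
  · have h₁ := D p₀ p₁ p₂ p₃ p₁ p₂ p₃ x
    have h₂ := D p₀ p₁ p₂ p₃ p₀ p₁ p₃ x
    simp only [*] at h₁ h₂
    exact Or.inl (by
      linear_combination ((-1) + (-3) * τ + (-9) * τ ^ 2 + (-27) * τ ^ 3) * h₁ + (81 * τ ^ 2) * h₂)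
  · have h₁ := D p₀ p₁ p₂ p₃ p₀ p₁ p₂ x
    have h₂ := D p₀ p₁ p₂ p₃ p₀ p₁ p₃ x
    simp only [*] at h₁ h₂
    exact Or.inl (by linear_combination h₁ + h₂)
  · have h₁ := D p₀ p₁ p₂ p₃ p₀ p₁ p₃ x
    simp only [*] at h₁
    -- The minor equals `(τ + 1) ^ 2`, so its vanishing gives `τ = -1` only because a field is
    -- reduced.
    exact Or.inl (eq_neg_of_add_eq_zero_left (pow_eq_zero_iff (n := 2) (by norm_num) |>.mp
      (by linear_combination h₁)))
  · have h₁ := D p₀ p₁ p₂ p₃ p₀ p₁ p₂ x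
    have h₂ := D p₀ p₁ p₂ p₃ p₀ p₂ p₃ x
    simp only [*] at h₁ h₂
    exact of_one_eq_zero F (by linear_combination (-2) * h₁ + h₂)
  · have h₁ := D p₀ p₁ p₂ p₃ p₀ p₂ p₃ x
    have h₂ := D p₀ p₁ p₂ p₃ p₀ p₁ p₃ x
    simp only [*] at h₁ h₂
    exact of_one_eq_zero F (by
      linear_combination ((-1) + (-1) * τ + (-3) * τ ^ 3) * h₁ + (1 + (-3) * τ + (-6) * τ ^ 2) * h₂)
  · have h₁ := D p₀ p₁ p₂ p₃ p₀ p₁ p₂ x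
    have h₂ := D p₀ p₁ p₂ p₃ p₀ p₁ p₃ x
    simp only [*] at h₁ h₂
    exact of_one_eq_zero F (by linear_combination (-2) * h₁ - h₂)
  · have h₁ := D p₀ p₁ p₂ p₃ p₀ p₁ p₃ x
    have h₂ := D p₀ p₁ p₂ p₃ p₀ p₂ p₃ x
    simp only [*] at h₁ h₂
    exact of_one_eq_zero F (by
      linear_combination (1 + τ + 3 * τ ^ 3) * h₁ + ((-1) + 3 * τ + 6 * τ ^ 2) * h₂)
  · have h₁ := D p₀ p₁ p₂ p₃ p₀ p₁ p₂ x
    have h₂ := D p₀ p₁ p₂ p₃ p₀ p₁ p₃ x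
    simp only [*] at h₁ h₂
    exact Or.inl (by linear_combination -τ * h₁ - h₂)
  · have h₁ := D p₀ p₁ p₂ p₃ p₀ p₁ p₂ x
    have h₂ := D p₀ p₁ p₂ p₃ p₀ p₁ p₃ x
    simp only [*] at h₁ h₂
    exact Or.inl (eq_neg_of_add_eq_zero_left (pow_eq_zero_iff (n := 2) (by norm_num) |>.mp
      (by linear_combination h₁ + h₂)))

theorem path_neighbor_pair {w : V → V → F} {τ : F} (D : MinorsVanish w)
    (hs : ∀ u v, w u v = w v u) (hd : ∀ v, w v v = τ) {p₀ p₁ p₂ p₃ x y : V}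
    (h₀₁ : w p₀ p₁ = -1) (h₀₂ : w p₀ p₂ = 0) (h₀₃ : w p₀ p₃ = 0)
    (h₁₂ : w p₁ p₂ = -1) (h₁₃ : w p₁ p₃ = 0) (h₂₃ : w p₂ p₃ = -1)
    (hx : (w p₀ x = -1 ∧ w p₁ x = 0 ∧ w p₂ x = 0 ∧ w p₃ x = -1) ∨
      (w p₀ x = -1 ∧ w p₁ x = -1 ∧ w p₂ x = 0 ∧ w p₃ x = -1) ∨
      (w p₀ x = -1 ∧ w p₁ x = 0 ∧ w p₂ x = -1 ∧ w p₃ x = -1))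
    (hy : (w p₀ y = -1 ∧ w p₁ y = 0 ∧ w p₂ y = 0 ∧ w p₃ y = -1) ∨
      (w p₀ y = -1 ∧ w p₁ y = -1 ∧ w p₂ y = 0 ∧ w p₃ y = -1) ∨
      (w p₀ y = -1 ∧ w p₁ y = 0 ∧ w p₂ y = -1 ∧ w p₃ y = -1))
    (e : w x y = 0 ∨ w x y = -1) :
    w x y = 0 ∧ ((w p₁ x = -1 ∧ w p₂ y = -1) ∨ (w p₂ x = -1 ∧ w p₁ y = -1)) := by
  have h₁₀ : w p₁ p₀ = -1 := by rw [hs, h₀₁]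
  have h₂₀ : w p₂ p₀ = 0 := by rw [hs, h₀₂]
  have h₃₀ : w p₃ p₀ = 0 := by rw [hs, h₀₃]
  have h₂₁ : w p₂ p₁ = -1 := by rw [hs, h₁₂]
  have h₃₁ : w p₃ p₁ = 0 := by rw [hs, h₁₃]
  have h₃₂ : w p₃ p₂ = -1 := by rw [hs, h₂₃]
  have s₀ := hs x p₀
  have s₁ := hs x p₁
  have s₂ := hs x p₂
  have s₃ := hs x p₃
  have t₀ := hs y p₀
  have t₁ := hs y p₁
  have t₂ := hs y p₂
  have t₃ := hs y p₃
  have e' := hs y x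
  clear hs
  rcases hx with ⟨c₀, c₁, c₂, c₃⟩ | ⟨c₀, c₁, c₂, c₃⟩ | ⟨c₀, c₁, c₂, c₃⟩ <;>
    rcases hy with ⟨d₀, d₁, d₂, d₃⟩ | ⟨d₀, d₁, d₂, d₃⟩ | ⟨d₀, d₁, d₂, d₃⟩ <;>
    rw [c₀] at s₀ <;> rw [c₁] at s₁ <;> rw [c₂] at s₂ <;> rw [c₃] at s₃ <;>
    rw [d₀] at t₀ <;> rw [d₁] at t₁ <;> rw [d₂] at t₂ <;> rw [d₃] at t₃ <;>
    rcases e with e | e <;> rw [e] at e'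
  · have h₁ := D p₀ p₁ p₂ x p₀ p₁ x y
    have h₂ := D p₀ p₁ p₂ x p₀ p₁ p₃ y
    simp only [*] at h₁ h₂
    exact of_one_eq_zero F (by linear_combination h₁ - h₂)
  · have h₁ := D p₀ p₁ p₂ x p₀ p₂ p₃ y
    simp only [*] at h₁
    exact of_one_eq_zero F (by linear_combination -h₁)
  · have h₁ := D p₀ p₁ p₂ p₃ p₀ p₁ x y
    have h₂ := D p₀ p₁ p₂ p₃ p₁ p₂ x y
    simp only [*] at h₁ h₂
    exact of_one_eq_zero F (by linear_combination -h₁ + h₂)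
  · have h₁ := D p₀ p₁ p₂ x p₂ p₃ x y
    simp only [*] at h₁
    exact of_one_eq_zero F (by linear_combination h₁)
  · have h₁ := D p₀ p₁ p₂ p₃ p₀ p₃ x y
    have h₂ := D p₀ p₁ p₂ p₃ p₀ p₂ x y
    simp only [*] at h₁ h₂
    exact of_one_eq_zero F (by linear_combination h₁ - h₂)
  · have h₁ := D p₀ p₁ p₃ x p₁ p₂ p₃ y
    simp only [*] at h₁
    exact of_one_eq_zero F (by linear_combination -h₁)
  · have h₁ := D p₀ p₁ p₂ p₃ p₀ p₁ x y
    have h₂ := D p₀ p₁ p₂ p₃ p₁ p₂ x y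
    simp only [*] at h₁ h₂
    exact of_one_eq_zero F (by linear_combination h₁ - h₂)
  · have h₁ := D p₀ p₁ p₂ x p₀ p₂ p₃ y
    simp only [*] at h₁
    exact of_one_eq_zero F (by linear_combination -h₁)
  · have h₁ := D p₀ p₁ p₂ x p₂ p₃ x y
    have h₂ := D p₀ p₁ p₂ x p₀ p₁ p₃ y
    simp only [*] at h₁ h₂
    exact of_one_eq_zero F (by linear_combination -h₁ + h₂)
  · have h₁ := D p₀ p₁ p₃ x p₁ p₂ p₃ y
    have h₂ := D p₀ p₁ p₂ x p₂ p₃ x y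
    simp only [*] at h₁ h₂
    exact of_one_eq_zero F (by linear_combination -h₁ + h₂)
  · exact ⟨e, Or.inl ⟨c₁, d₂⟩⟩
  · have h₁ := D p₀ p₁ p₂ y p₂ p₃ x y
    simp only [*] at h₁
    exact of_one_eq_zero F (by linear_combination -h₁)
  · have h₁ := D p₀ p₁ p₂ p₃ p₀ p₃ x y
    have h₂ := D p₀ p₁ p₂ p₃ p₀ p₂ x y
    simp only [*] at h₁ h₂
    exact of_one_eq_zero F (by linear_combination -h₁ + h₂)
  · have h₁ := D p₀ p₁ p₃ y p₁ p₂ p₃ x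
    simp only [*] at h₁
    exact of_one_eq_zero F (by linear_combination -h₁)
  · exact ⟨e, Or.inr ⟨c₂, d₁⟩⟩
  · have h₁ := D p₀ p₁ p₂ x p₂ p₃ x y
    simp only [*] at h₁
    exact of_one_eq_zero F (by linear_combination h₁)
  · have h₁ := D p₀ p₁ p₂ x p₀ p₃ x y
    have h₂ := D p₀ p₁ p₃ x p₀ p₂ p₃ y
    simp only [*] at h₁ h₂
    exact of_one_eq_zero F (by linear_combination h₁ - h₂)
  · have h₁ := D p₀ p₁ p₂ x p₀ p₂ p₃ y
    have h₂ := D p₀ p₁ p₂ x p₀ p₁ p₃ y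
    simp only [*] at h₁ h₂
    exact of_one_eq_zero F (by linear_combination h₁ - h₂)
end

/-! ### The decreasing chain of characteristic ideals -/

theorem determinantalIdeal_succ_le {m n R : Type*} [CommRing R] (M : Matrix m n R) (k : ℕ) :
    determinantalIdeal M (k + 1) ≤ determinantalIdeal M k := by
  refine Ideal.span_le.mpr ?_
  rintro p ⟨r, c, rfl⟩
  rw [SetLike.mem_coe, Matrix.det_succ_row_zero]
  refine Ideal.sum_mem _ fun j _ => Ideal.mul_mem_left _ _ (Ideal.subset_span ?_)
  exact ⟨(Fin.succEmb k).trans r, (Fin.succAboveEmb j).trans c, rfl⟩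

theorem determinantalIdeal_antitone {m n R : Type*} [CommRing R] (M : Matrix m n R) :
    Antitone (determinantalIdeal M) :=
  antitone_nat_of_succ_le (determinantalIdeal_succ_le M)

namespace SimpleGraph

section Ideal
variable {V : Type*} [Fintype V] [DecidableEq V] (G : SimpleGraph V) [DecidableRel G.Adj]

theorem card_ge_of_characteristicIdeal_eq_top {k : ℕ} (h : G.characteristicIdeal k = ⊤) :
    k ≤ Fintype.card V := by
  by_contra hk
  have he : IsEmpty (Fin k ↪ V) := by
    by_contra hne
    obtain ⟨e⟩ := not_isEmpty_iff.mp hne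
    simpa [hk] using Fintype.card_le_of_embedding e
  have : {p : ℤ[X] | ∃ (r c : Fin k ↪ V),
      p = ((Matrix.charmatrix (G.adjMatrix ℤ)).submatrix r c).det} = ∅ := by
    ext p
    simp
  rw [characteristicIdeal, determinantalIdeal, this, Ideal.span_empty] at h
  exact bot_ne_top h

/-- By Laplace expansion the ideals decrease, so the trivial indices form an initial segment. The
bound by `|V|` in the count loses nothing: beyond it there are no minors and the ideal is zero. -/
theorem numTrivialCharacteristicIdeals_le_iff (k : ℕ) :
    G.numTrivialCharacteristicIdeals ≤ k ↔ G.characteristicIdeal (k + 1) ≠ ⊤ := by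
  have anti : Antitone G.characteristicIdeal := determinantalIdeal_antitone _
  constructor
  · intro h htop
    have hsub : (Set.Icc 1 (k + 1) : Set ℕ) ⊆
        {k : ℕ | 1 ≤ k ∧ k ≤ Fintype.card V ∧ G.characteristicIdeal k = ⊤} := fun j hj =>
      ⟨hj.1, hj.2.trans (G.card_ge_of_characteristicIdeal_eq_top htop),
        top_le_iff.mp (htop ▸ anti hj.2)⟩
    have hfin : {k : ℕ | 1 ≤ k ∧ k ≤ Fintype.card V ∧ G.characteristicIdeal k = ⊤}.Finite :=
      (Set.finite_Icc 1 (Fintype.card V)).subset fun j hj => ⟨hj.1, hj.2.1⟩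
    have := Set.ncard_le_ncard hsub hfin
    rw [← Finset.coe_Icc, Set.ncard_coe_finset, Nat.card_Icc] at this
    exact absurd (this.trans h) (by omega)
  · intro h
    have hsub : {k : ℕ | 1 ≤ k ∧ k ≤ Fintype.card V ∧ G.characteristicIdeal k = ⊤} ⊆
        Set.Icc 1 k := fun j hj => ⟨hj.1, by
      by_contra hlt
      exact h (top_le_iff.mp (hj.2.2 ▸ anti (by omega)))⟩
    have := Set.ncard_le_ncard hsub (Set.finite_Icc 1 k)
    rw [← Finset.coe_Icc, Set.ncard_coe_finset, Nat.card_Icc] at this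
    exact this.trans (by omega)

end Ideal

/-! ### Passing from ideals to matrices over a field -/

section Weight
variable {V W F : Type*} [CommRing F]

open Classical in
/-- The entries of `τ I - A(G)`. -/
noncomputable def weight (G : SimpleGraph V) (τ : F) (u v : V) : F :=
  if u = v then τ else if G.Adj u v then -1 else 0

variable {G : SimpleGraph V} {τ : F} {u v : V}

theorem weight_self (G : SimpleGraph V) (τ : F) (v : V) : G.weight τ v v = τ := by simp [weight]

theorem weight_of_adj (h : G.Adj u v) : G.weight τ u v = -1 := by simp [weight, h, h.ne]

theorem weight_of_not_adj (hne : u ≠ v) (h : ¬ G.Adj u v) : G.weight τ u v = 0 := by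
  simp [weight, h, hne]

theorem weight_eq_zero_or (hne : u ≠ v) : G.weight τ u v = 0 ∨ G.weight τ u v = -1 := by
  by_cases h : G.Adj u v
  · exact Or.inr (weight_of_adj h)
  · exact Or.inl (weight_of_not_adj hne h)

theorem weight_comm (G : SimpleGraph V) (τ : F) (u v : V) : G.weight τ u v = G.weight τ v u := by
  by_cases h : u = v
  · rw [h]
  · by_cases ha : G.Adj u v <;> simp [weight, h, Ne.symm h, ha, G.adj_comm v u]

theorem weight_eq_neg_one_iff [Nontrivial F] (hne : u ≠ v) : G.weight τ u v = -1 ↔ G.Adj u v := by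
  refine ⟨fun h => ?_, weight_of_adj⟩
  by_contra hn
  rw [weight_of_not_adj hne hn, eq_comm, neg_eq_zero] at h
  exact one_ne_zero h

theorem weight_eq_zero_iff [Nontrivial F] (hne : u ≠ v) : G.weight τ u v = 0 ↔ ¬ G.Adj u v := by
  refine ⟨fun h hn => ?_, weight_of_not_adj hne⟩
  rw [weight_of_adj hn, neg_eq_zero] at h
  exact one_ne_zero h

theorem Embedding.weight_eq {H : SimpleGraph W} (f : G ↪g H) (τ : F) (u v : V) :
    H.weight τ (f u) (f v) = G.weight τ u v := by
  by_cases h : u = v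
  · simp [weight, h]
  · by_cases ha : G.Adj u v <;> simp [weight, h, ha]

theorem map_charmatrix_adjMatrix [Fintype V] [DecidableEq V] (G : SimpleGraph V)
    [DecidableRel G.Adj] (φ : ℤ[X] →+* F) (u v : V) :
    φ (Matrix.charmatrix (G.adjMatrix ℤ) u v) = G.weight (φ X) u v := by
  by_cases h : u = v
  · subst h
    simp [Matrix.charmatrix_apply_eq, weight]
  · by_cases ha : G.Adj u v <;> simp [weight, h, ha]

theorem map_charmatrix_minor [Fintype V] [DecidableEq V] (G : SimpleGraph V)
    [DecidableRel G.Adj] (φ : ℤ[X] →+* F) {k : ℕ} (r c : Fin k → V) :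
    φ ((Matrix.charmatrix (G.adjMatrix ℤ)).submatrix r c).det =
      ((Matrix.of (G.weight (φ X))).submatrix r c).det := by
  rw [RingHom.map_det]
  congr 1
  ext i j
  simp [map_charmatrix_adjMatrix]

end Weight

/-- A proper ideal lies in a maximal one; `F` is the residue field and `τ` the class of `X`. -/
theorem exists_minorsVanish {V : Type*} [Fintype V] [DecidableEq V] (G : SimpleGraph V)
    [DecidableRel G.Adj] (h : G.characteristicIdeal 4 ≠ ⊤) :
    ∃ (F : Type) (_ : Field F) (τ : F), MinorsVanish (G.weight τ) := by
  obtain ⟨I, hI, hle⟩ := Ideal.exists_le_maximal _ h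
  let _ := Ideal.Quotient.field I
  refine ⟨ℤ[X] ⧸ I, inferInstance, Ideal.Quotient.mk I X, ?_⟩
  rw [minorsVanish_iff]
  intro r c
  by_cases hr : Function.Injective r
  · by_cases hc : Function.Injective c
    · rw [← map_charmatrix_minor]
      exact Ideal.Quotient.eq_zero_iff_mem.mpr (hle (Ideal.subset_span ⟨⟨r, hr⟩, ⟨c, hc⟩, rfl⟩))
    · simp only [Function.Injective, not_forall] at hc
      obtain ⟨i, j, hij, hne⟩ := hc
      exact Matrix.det_zero_of_column_eq hne fun k => by simp [hij]
  · simp only [Function.Injective, not_forall] at hr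
    obtain ⟨i, j, hij, hne⟩ := hr
    exact Matrix.det_zero_of_row_eq hne (by ext k; simp [hij])

/-- If `τ I - A(H)` factors through a space of dimension `k`, the `(k + 1)`-st characteristic ideal
of every induced subgraph of `H` is nontrivial. -/
theorem characteristicIdeal_ne_top_of_factors {V W F : Type*} [Fintype V] [DecidableEq V]
    {G : SimpleGraph V} [DecidableRel G.Adj] {H : SimpleGraph W} (hGH : G.IsIndContained H)
    [Field F] (τ : F) {k : ℕ} (B : W → Fin k → F) (C : Fin k → W → F)
    (hBC : ∀ u v, H.weight τ u v = ∑ i, B u i * C i v) : G.characteristicIdeal (k + 1) ≠ ⊤ := by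
  obtain ⟨f⟩ := hGH
  let φ : ℤ[X] →+* F := eval₂RingHom (Int.castRingHom F) τ
  have hφ : φ X = τ := by simp [φ]
  intro htop
  have hle : G.characteristicIdeal (k + 1) ≤ RingHom.ker φ := by
    refine Ideal.span_le.mpr ?_
    rintro p ⟨r, c, rfl⟩
    rw [SetLike.mem_coe, RingHom.mem_ker, map_charmatrix_minor, hφ]
    have : (Matrix.of (G.weight τ)).submatrix r c =
        Matrix.of (fun i j => B (f (r i)) j) * Matrix.of (fun i j => C i (f (c j))) := by
      ext i j
      simp [Matrix.mul_apply, ← f.weight_eq, hBC]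
    -- A nonzero minor would be an invertible matrix of size `k + 1` factoring through dimension
    -- `k`.
    by_contra hdet
    have h1 := Matrix.rank_of_isUnit _ ((Matrix.isUnit_iff_isUnit_det _).mpr
      (isUnit_iff_ne_zero.mpr hdet))
    rw [this] at h1
    have h2 := (Matrix.rank_mul_le_left (Matrix.of fun (i : Fin (k + 1)) (j : Fin k) => B (f (r i)) j)
      (Matrix.of fun i j => C i (f (c j)))).trans (Matrix.rank_le_width _)
    rw [h1, Fintype.card_fin] at h2
    omega
  rw [htop, top_le_iff] at hle
  have : (1 : ℤ[X]) ∈ RingHom.ker φ := hle ▸ Submodule.mem_top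
  simp at this

/-! ### Rank-three factorizations for the five families -/

theorem characteristicIdeal_ne_top_of_cycleGraph_five {V : Type*} [Fintype V] [DecidableEq V]
    {G : SimpleGraph V} [DecidableRel G.Adj] (h : G.IsIndContained (cycleGraph 5)) :
    G.characteristicIdeal 4 ≠ ⊤ := by
  -- At `τ = 2` this is the Laplacian of the cycle, of rank 3 modulo 5. The right factor is its
  -- first three rows, the left one expresses all rows through them.
  have key : ∀ u v : Fin 5, (if u = v then 2 else if (cycleGraph 5).Adj u v then -1 else 0) =
      ∑ i : Fin 3, (![![1, 0, 0], ![0, 1, 0], ![0, 0, 1], ![1, 2, 3], ![3, 2, 1]] :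
        Fin 5 → Fin 3 → ZMod 5) u i *
      (![![2, 4, 0, 0, 4], ![4, 2, 4, 0, 0], ![0, 4, 2, 4, 0]] : Fin 3 → Fin 5 → ZMod 5) i v := by
    decide
  have : Fact (Nat.Prime 5) := ⟨by norm_num⟩
  refine characteristicIdeal_ne_top_of_factors h (2 : ZMod 5)
    (![![1, 0, 0], ![0, 1, 0], ![0, 0, 1], ![1, 2, 3], ![3, 2, 1]])
    (![![2, 4, 0, 0, 4], ![4, 2, 4, 0, 0], ![0, 4, 2, 4, 0]]) fun u v => ?_
  rw [← key, weight]
  congr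

theorem characteristicIdeal_ne_top_of_prism {V : Type*} [Fintype V] [DecidableEq V]
    {G : SimpleGraph V} [DecidableRel G.Adj]
    (h : G.IsIndContained (boxProd (completeGraph (Fin 3)) (completeGraph (Fin 2)))) :
    G.characteristicIdeal 4 ≠ ⊤ := by
  -- Again a Laplacian of rank 3 modulo 5, since the prism is 3-regular; the rows of one triangle
  -- span.
  let w : Fin 3 × Fin 2 → Fin 3 × Fin 2 → ZMod 5 := fun u v =>
    if u = v then 3 else if u.1 ≠ v.1 ∧ u.2 = v.2 ∨ u.2 ≠ v.2 ∧ u.1 = v.1 then -1 else 0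
  have key : ∀ u v, w u v = ∑ i : Fin 3,
      (if u.2 = 0 then if u.1 = i then 1 else 0 else if u.1 = i then 2 else 1) * w (i, 0) v := by
    decide
  have : Fact (Nat.Prime 5) := ⟨by norm_num⟩
  refine characteristicIdeal_ne_top_of_factors h (3 : ZMod 5)
    (fun u i => if u.2 = 0 then if u.1 = i then 1 else 0 else if u.1 = i then 2 else 1)
    (fun i v => w (i, 0) v) fun u v => ?_
  rw [← key, weight]
  simp only [w, boxProd_adj, completeGraph_eq_top, top_adj]

theorem characteristicIdeal_ne_top_of_completeMultipartite {V : Type*} [Fintype V]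
    [DecidableEq V] {G : SimpleGraph V} [DecidableRel G.Adj] {X : Fin 4 → Type*}
    (h : G.IsIndContained (completeMultipartiteGraph X)) :
    G.characteristicIdeal 4 ≠ ⊤ := by
  -- At `τ = 0` vertices of one part have equal rows, leaving `-A(K_4)`, whose four rows sum to zero
  -- modulo 3.
  let N : Fin 4 → Fin 4 → ZMod 3 := fun i j => if i = j then 0 else -1
  let B : Fin 4 → Fin 3 → ZMod 3 := ![![1, 0, 0], ![0, 1, 0], ![0, 0, 1], ![-1, -1, -1]]
  refine characteristicIdeal_ne_top_of_factors h (0 : ZMod 3)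
    (fun u => B u.1) (fun i v => N i.castSucc v.1) fun u v => ?_
  have key : ∀ u v, N u v = ∑ i : Fin 3, B u i * N i.castSucc v := by decide
  rw [← key, weight]
  by_cases h1 : u = v
  · simp [h1, N]
  · by_cases h2 : u.1 = v.1 <;> simp [h1, h2, N]

/-- At `τ = -1` the diagonal agrees with the entry of an edge, so vertices of one clique have equal
rows and the blow-up does not raise the rank. -/
theorem weight_blowup {W F : Type*} [CommRing F] (H : SimpleGraph W) {r : W → ℤ}
    (hr : ∀ i, r i < 0) (u v : Σ i : W, Fin (r i).natAbs) :
    (H.blowup r).weight (-1 : F) u v = H.weight (-1 : F) u.1 v.1 := by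
  by_cases h1 : u = v
  · simp [h1, weight]
  · by_cases h2 : u.1 = v.1
    · simp [h1, h2, weight, blowup, hr]
    · by_cases h3 : H.Adj u.1 v.1 <;> simp [h1, h2, h3, weight, blowup]

theorem characteristicIdeal_ne_top_of_cycleGraph_four_blowup {V : Type*} [Fintype V]
    [DecidableEq V] {G : SimpleGraph V} [DecidableRel G.Adj] {r : Fin 4 → ℤ} (hr : ∀ i, r i < 0)
    (h : G.IsIndContained ((cycleGraph 4).blowup r)) : G.characteristicIdeal 4 ≠ ⊤ := by
  -- Closed neighbourhoods in `C_4` have three elements, so the rows sum to zero modulo 3.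
  let N : Fin 4 → Fin 4 → ZMod 3 := fun i j =>
    if i = j then -1 else if (cycleGraph 4).Adj i j then -1 else 0
  let B : Fin 4 → Fin 3 → ZMod 3 := ![![1, 0, 0], ![0, 1, 0], ![0, 0, 1], ![-1, -1, -1]]
  refine characteristicIdeal_ne_top_of_factors h (-1 : ZMod 3)
    (fun u => B u.1) (fun i v => N i.castSucc v.1) fun u v => ?_
  have key : ∀ u v, N u v = ∑ i : Fin 3, B u i * N i.castSucc v := by decide
  rw [← key, weight_blowup _ hr, weight]
  simp only [N]
  congr

theorem characteristicIdeal_ne_top_of_starGraph_blowup {V : Type*} [Fintype V]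
    [DecidableEq V] {G : SimpleGraph V} [DecidableRel G.Adj] {r : Fin 4 → ℤ} (hr : ∀ i, r i < 0)
    (h : G.IsIndContained ((starGraph (0 : Fin 4)).blowup r)) : G.characteristicIdeal 4 ≠ ⊤ := by
  -- Closed neighbourhoods in the star have four or two elements, so the rows sum to zero modulo 2.
  let N : Fin 4 → Fin 4 → ZMod 2 := fun i j =>
    if i = j then -1 else if (starGraph (0 : Fin 4)).Adj i j then -1 else 0
  let B : Fin 4 → Fin 3 → ZMod 2 := ![![1, 0, 0], ![0, 1, 0], ![0, 0, 1], ![1, 1, 1]]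
  refine characteristicIdeal_ne_top_of_factors h (-1 : ZMod 2)
    (fun u => B u.1) (fun i v => N i.castSucc v.1) fun u v => ?_
  have key : ∀ u v, N u v = ∑ i : Fin 3, B u i * N i.castSucc v := by decide
  rw [← key, weight_blowup _ hr, weight]
  simp only [N]
  congr

end SimpleGraph

/-! ### Constructing embeddings; graphs without induced four-vertex paths -/

namespace SimpleGraph

variable {V W : Type*} {G : SimpleGraph V} {H : SimpleGraph W}

theorem isIndContained_of_surjective {ι : Type*} [LinearOrder ι] {g : ι → V}
    (hg : Function.Surjective g) {k : ι → W} (hk : Function.Injective k)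
    (h : ∀ i j, i < j → (G.Adj (g i) (g j) ↔ H.Adj (k i) (k j))) : G.IsIndContained H := by
  have h' : ∀ i j, G.Adj (g i) (g j) ↔ H.Adj (k i) (k j) := by
    intro i j
    rcases lt_trichotomy i j with hij | rfl | hij
    · exact h i j hij
    · simp
    · rw [G.adj_comm, H.adj_comm]
      exact h j i hij
  refine ⟨⟨⟨fun v => k (Function.surjInv hg v), hk.comp (Function.injective_surjInv hg)⟩, ?_⟩⟩
  intro u v
  simp [← h', Function.surjInv_eq hg]

theorem isIndContained_blowup [Fintype V] [Nonempty V] (c : V → W)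
    (hc : ∀ x y, x ≠ y → (G.Adj x y ↔ c x = c y ∨ H.Adj (c x) (c y))) :
    ∃ r : W → ℤ, (∀ i, r i < 0) ∧ G.IsIndContained (H.blowup r) := by
  have hn : 0 < Fintype.card V := Fintype.card_pos
  -- Every clique gets room for all of `V`, so one enumeration of `V` serves for all colours and
  -- unused colours still have negative entries.
  refine ⟨fun _ => -(Fintype.card V : ℤ), fun _ => by simpa using hn, ?_⟩
  let e : V ≃ Fin (-(Fintype.card V : ℤ)).natAbs := (Fintype.equivFin V).trans (finCongr (by simp))
  refine ⟨⟨⟨fun v => ⟨c v, e v⟩, fun u v huv => ?_⟩, ?_⟩⟩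
  · simp only [Sigma.mk.injEq] at huv
    exact e.injective (eq_of_heq huv.2)
  · intro u v
    by_cases huv : u = v
    · simp [huv]
    · rw [hc u v huv]
      have : (⟨c u, e u⟩ : Σ _ : W, Fin (-(Fintype.card V : ℤ)).natAbs) ≠ ⟨c v, e v⟩ := by
        intro h
        simp only [Sigma.mk.injEq] at h
        exact huv (e.injective (eq_of_heq h.2))
      simp only [blowup]
      constructor
      · rintro (h | h)
        · exact Or.inr h
        · exact Or.inl h.1
      · rintro (h | h)
        · exact Or.inr ⟨h, by simpa using hn, this⟩
        · exact Or.inl h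

theorem IsCompleteMultipartite.isIndContained_or_exists_pairwise_adj [Fintype V] [Nonempty V]
    (hm : G.IsCompleteMultipartite) (k : ℕ) :
    (∃ s : Fin k → ℕ, (∀ i, 0 < s i) ∧
      G.IsIndContained (completeMultipartiteGraph fun i => Fin (s i))) ∨
    ∃ f : Fin (k + 1) → V, ∀ i j, i ≠ j → G.Adj (f i) (f j) := by
  classical
  have hadj : ∀ u v, G.Adj u v ↔ Quotient.mk hm.setoid u ≠ Quotient.mk hm.setoid v := by
    intro u v
    rw [Ne, Quotient.eq]
    change _ ↔ ¬¬ G.Adj u v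
    rw [not_not]
  rcases Nat.lt_or_ge k (Fintype.card (Quotient hm.setoid)) with hk | hk
  · right
    obtain ⟨f⟩ := Function.Embedding.nonempty_of_card_le
      (α := Fin (k + 1)) (β := Quotient hm.setoid) (by simpa using hk)
    refine ⟨fun i => (f i).out, fun i j hij => ?_⟩
    rw [hadj, Quotient.out_eq, Quotient.out_eq]
    exact fun h => hij (f.injective h)
  · left
    obtain ⟨f⟩ := Function.Embedding.nonempty_of_card_le
      (α := Quotient hm.setoid) (β := Fin k) (by simpa using hk)
    refine ⟨fun _ => Fintype.card V, fun _ => Fintype.card_pos, ?_⟩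
    refine ⟨⟨⟨fun v => ⟨f (Quotient.mk _ v), Fintype.equivFin V v⟩, fun u v huv => ?_⟩, ?_⟩⟩
    · simp only [Sigma.mk.injEq] at huv
      exact (Fintype.equivFin V).injective (eq_of_heq huv.2)
    · intro u v
      rw [hadj]
      simp only [completeMultipartiteGraph, comap_adj, top_adj]
      exact f.injective.ne_iff

/-- The vertices `a, b, c, d` form, in this order, an induced path. -/
structure IsInducedPath (G : SimpleGraph V) (a b c d : V) : Prop where
  ab : G.Adj a b
  bc : G.Adj b c
  cd : G.Adj c d
  ac : ¬ G.Adj a c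
  bd : ¬ G.Adj b d
  ad : ¬ G.Adj a d

theorem IsInducedPath.ne_ac {a b c d : V} (h : G.IsInducedPath a b c d) : a ≠ c :=
  fun e => h.ad (e ▸ h.cd)

theorem IsInducedPath.ne_bd {a b c d : V} (h : G.IsInducedPath a b c d) : b ≠ d :=
  fun e => h.ad (e ▸ h.ab)

theorem IsInducedPath.ne_ad {a b c d : V} (h : G.IsInducedPath a b c d) : a ≠ d :=
  fun e => h.ac (e ▸ h.cd.symm)

/-- Induction along a walk: a shortest path of length three would be induced. -/
theorem Reachable.exists_common_neighbor (hG : ∀ a b c d, ¬ G.IsInducedPath a b c d) {u v : V}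
    (h : G.Reachable u v) : u = v ∨ G.Adj u v ∨ ∃ c, G.Adj u c ∧ G.Adj c v := by
  obtain ⟨p⟩ := h
  induction p with
  | nil => exact Or.inl rfl
  | @cons u u' v ha _ ih =>
    rcases ih with rfl | h | ⟨c, h1, h2⟩
    · exact Or.inr (Or.inl ha)
    · exact Or.inr (Or.inr ⟨u', ha, h⟩)
    · by_cases h3 : G.Adj u c
      · exact Or.inr (Or.inr ⟨c, h3, h2⟩)
      · by_cases h4 : G.Adj u v
        · exact Or.inr (Or.inl h4)
        · by_cases h5 : G.Adj u' v
          · exact Or.inr (Or.inr ⟨u', ha, h5⟩)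
          · exact (hG u u' c v ⟨ha, h1, h2, h3, h5, h4⟩).elim

/-! ### Graph structure forced by vanishing minors -/

section Weighted
variable {F : Type*} [Field F] {τ : F}

theorem IsInducedPath.weight_types (D : MinorsVanish (G.weight τ)) {a b c d : V}
    (h : G.IsInducedPath a b c d) {x : V} (ha : x ≠ a) (hb : x ≠ b) (hc : x ≠ c) (hd : x ≠ d) :
    let w := G.weight τ
    (w a x = -1 ∧ w b x = 0 ∧ w c x = 0 ∧ w d x = -1) ∨
    (w a x = -1 ∧ w b x = -1 ∧ w c x = 0 ∧ w d x = -1) ∨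
    (w a x = -1 ∧ w b x = 0 ∧ w c x = -1 ∧ w d x = -1) :=
  path_neighbor_types D (weight_comm G τ) (weight_self G τ) (weight_of_adj h.ab)
    (weight_of_not_adj h.ne_ac h.ac) (weight_of_not_adj h.ne_ad h.ad) (weight_of_adj h.bc)
    (weight_of_not_adj h.ne_bd h.bd) (weight_of_adj h.cd) (weight_eq_zero_or ha.symm)
    (weight_eq_zero_or hb.symm) (weight_eq_zero_or hc.symm) (weight_eq_zero_or hd.symm)

theorem IsInducedPath.neighbor_types (D : MinorsVanish (G.weight τ)) {a b c d : V}
    (h : G.IsInducedPath a b c d) {x : V} (ha : x ≠ a) (hb : x ≠ b) (hc : x ≠ c) (hd : x ≠ d) :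
    (G.Adj a x ∧ ¬ G.Adj b x ∧ ¬ G.Adj c x ∧ G.Adj d x) ∨
    (G.Adj a x ∧ G.Adj b x ∧ ¬ G.Adj c x ∧ G.Adj d x) ∨
    (G.Adj a x ∧ ¬ G.Adj b x ∧ G.Adj c x ∧ G.Adj d x) := by
  simpa only [weight_eq_zero_iff hb.symm, weight_eq_zero_iff hc.symm, weight_eq_neg_one_iff ha.symm,
    weight_eq_neg_one_iff hb.symm, weight_eq_neg_one_iff hc.symm, weight_eq_neg_one_iff hd.symm]
    using h.weight_types D ha hb hc hd

theorem IsInducedPath.neighbor_pair (D : MinorsVanish (G.weight τ)) {a b c d : V}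
    (h : G.IsInducedPath a b c d) {x y : V} (ha : x ≠ a) (hb : x ≠ b) (hc : x ≠ c) (hd : x ≠ d)
    (ha' : y ≠ a) (hb' : y ≠ b) (hc' : y ≠ c) (hd' : y ≠ d) (hxy : x ≠ y) :
    ¬ G.Adj x y ∧ ((G.Adj b x ∧ G.Adj c y) ∨ (G.Adj c x ∧ G.Adj b y)) := by
  have := path_neighbor_pair D (weight_comm G τ) (weight_self G τ) (weight_of_adj h.ab)
    (weight_of_not_adj h.ne_ac h.ac) (weight_of_not_adj h.ne_ad h.ad) (weight_of_adj h.bc)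
    (weight_of_not_adj h.ne_bd h.bd) (weight_of_adj h.cd) (h.weight_types D ha hb hc hd)
    (h.weight_types D ha' hb' hc' hd') (weight_eq_zero_or hxy)
  simpa only [weight_eq_zero_iff hxy, weight_eq_neg_one_iff hb.symm, weight_eq_neg_one_iff hc.symm,
    weight_eq_neg_one_iff hb'.symm, weight_eq_neg_one_iff hc'.symm] using this

theorem IsInducedPath.isIndContained (D : MinorsVanish (G.weight τ)) {a b c d : V}
    (h : G.IsInducedPath a b c d) :
    G.IsIndContained (cycleGraph 5) ∨
      G.IsIndContained (boxProd (completeGraph (Fin 3)) (completeGraph (Fin 2))) := by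
  have types := fun x => h.neighbor_types D (x := x)
  have pair := fun x y => h.neighbor_pair D (x := x) (y := y)
  obtain ⟨ab, bc, cd, ac, bd, ad⟩ := h
  by_cases hX : ∃ x, x ≠ a ∧ x ≠ b ∧ x ≠ c ∧ x ≠ d
  · obtain ⟨x, xa, xb, xc, xd⟩ := hX
    by_cases hY : ∃ y, y ≠ a ∧ y ≠ b ∧ y ≠ c ∧ y ≠ d ∧ y ≠ x
    · obtain ⟨y, ya, yb, yc, yd, yx⟩ := hY
      right
      wlog hxy : G.Adj b x ∧ G.Adj c y generalizing x y
      · rcases (pair x y xa xb xc xd ya yb yc yd yx.symm).2 with h | h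
        · exact absurd h hxy
        · exact this y ya yb yc yd x xa xb xc xd yx.symm h.symm
      obtain ⟨bx, cy⟩ := hxy
      have nxy := (pair x y xa xb xc xd ya yb yc yd yx.symm).1
      obtain ⟨ax, -, cx, dx⟩ := ((types x xa xb xc xd).resolve_left fun h => h.2.1 bx).resolve_right
        fun h => h.2.1 bx
      obtain ⟨ay, nby, -, dy⟩ := ((types y ya yb yc yd).resolve_left
        fun h => h.2.2.1 cy).resolve_left fun h => h.2.2.1 cy
      -- A seventh vertex would be paired with both `x` and `y`, hence adjacent to both `b` and `c`,
      -- which no type allows.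
      have all : ∀ z, z = a ∨ z = b ∨ z = c ∨ z = d ∨ z = x ∨ z = y := by
        intro z
        by_contra! hz
        obtain ⟨za, zb, zc, zd, zx, zy⟩ := hz
        have cz := ((pair x z xa xb xc xd za zb zc zd zx.symm).2.resolve_right fun h => cx h.1).2
        have bz := ((pair y z ya yb yc yd za zb zc zd zy.symm).2.resolve_left fun h => nby h.1).2
        rcases types z za zb zc zd with h | h | h
        exacts [h.2.1 bz, h.2.2.1 cz, h.2.1 bz]
      refine isIndContained_of_surjective (g := ![a, b, c, d, x, y]) (fun z => ?_)
        -- The triangles of the prism are `a b x` and `y c d`.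
        (k := ![(0, 0), (1, 0), (1, 1), (2, 1), (2, 0), (0, 1)]) (by decide) fun i j hij => ?_
      · rcases all z with rfl | rfl | rfl | rfl | rfl | rfl
        exacts [⟨0, rfl⟩, ⟨1, rfl⟩, ⟨2, rfl⟩, ⟨3, rfl⟩, ⟨4, rfl⟩, ⟨5, rfl⟩]
      · fin_cases i <;> fin_cases j <;>
          simp [ab, bc, cd, ac, bd, ad, ax, bx, cx, dx, ay, nby, cy, dy, nxy] at hij ⊢
    · have all : ∀ z, z = a ∨ z = b ∨ z = c ∨ z = d ∨ z = x := by
        intro z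
        by_contra! hz
        exact hY ⟨z, hz⟩
      have surj : Function.Surjective ![a, b, c, d, x] := by
        intro z
        rcases all z with rfl | rfl | rfl | rfl | rfl
        exacts [⟨0, rfl⟩, ⟨1, rfl⟩, ⟨2, rfl⟩, ⟨3, rfl⟩, ⟨4, rfl⟩]
      rcases types x xa xb xc xd with ⟨ax, bx, cx, dx⟩ | ⟨ax, bx, cx, dx⟩ | ⟨ax, bx, cx, dx⟩
      · left
        refine isIndContained_of_surjective surj Function.injective_id fun i j hij => ?_
        fin_cases i <;> fin_cases j <;>
          first
            | exact absurd hij (by decide)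
            | exact iff_of_true (by simp [ab, bc, cd, ac, bd, ad, ax, bx, cx, dx]) (by decide)
            | exact iff_of_false (by simp [ab, bc, cd, ac, bd, ad, ax, bx, cx, dx]) (by decide)
      · right
        refine isIndContained_of_surjective surj
          (k := ![(0, 0), (1, 0), (1, 1), (2, 1), (2, 0)]) (by decide) fun i j hij => ?_
        fin_cases i <;> fin_cases j <;>
          simp [ab, bc, cd, ac, bd, ad, ax, bx, cx, dx] at hij ⊢
      · right
        refine isIndContained_of_surjective surj
          (k := ![(0, 0), (1, 0), (1, 1), (2, 1), (0, 1)]) (by decide) fun i j hij => ?_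
        fin_cases i <;> fin_cases j <;>
          simp [ab, bc, cd, ac, bd, ad, ax, bx, cx, dx] at hij ⊢
  · left
    have all : ∀ z, z = a ∨ z = b ∨ z = c ∨ z = d := by
      intro z
      by_contra! hz
      exact hX ⟨z, hz⟩
    refine isIndContained_of_surjective (g := ![a, b, c, d]) (fun z => ?_)
      (k := Fin.castSucc) (Fin.castSucc_injective 4) fun i j hij => ?_
    · rcases all z with rfl | rfl | rfl | rfl
      exacts [⟨0, rfl⟩, ⟨1, rfl⟩, ⟨2, rfl⟩, ⟨3, rfl⟩]
    · fin_cases i <;> fin_cases j <;>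
        first
          | exact absurd hij (by decide)
          | exact iff_of_true (by simp [ab, bc, cd, ac, bd, ad]) (by decide)
          | exact iff_of_false (by simp [ab, bc, cd, ac, bd, ad]) (by decide)

/-- When the diagonal is `-1` and the `4`-minors vanish, a matrix entry is determined by the position
of its two indices relative to an induced path on three vertices `e, h, g`. -/
theorem _root_.MinorsVanish.eq_of_path_three {w : V → V → F} (D : MinorsVanish w)
    (hs : ∀ u v, w u v = w v u) (hd : ∀ v, w v v = -1) {h e g : V} (he : w h e = -1)
    (hg : w h g = -1) (heg : w e g = 0) (x y : V) :
    w x y = w h x * w h y - w h x * w e y - w h x * w g y - w e x * w h y - w g x * w h y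
      + w e x * w g y + w g x * w e y := by
  -- The principal minor on `h, e, g` equals 1, so this bordered minor can be solved for `w x y`.
  have h1 := D h e g x h e g y
  simp only [he, hg, heg, hs e h, hs g h, hs g e, hs x h, hs x e, hs x g, hd] at h1
  linear_combination h1

theorem weight_neg_one_eq_or (G : SimpleGraph V) (u v : V) :
    G.weight (-1 : F) u v = 0 ∨ G.weight (-1 : F) u v = -1 := by
  by_cases h : u = v
  · rw [h, weight_self]
    exact Or.inr rfl
  · exact weight_eq_zero_or h

theorem isIndContained_of_minorsVanish_neg_one [Fintype V] (hG : G.Connected)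
    (D : MinorsVanish (G.weight (-1 : F))) :
    (∃ r : Fin 4 → ℤ, (∀ i, r i < 0) ∧ G.IsIndContained ((cycleGraph 4).blowup r)) ∨
    (∃ r : Fin 4 → ℤ, (∀ i, r i < 0) ∧ G.IsIndContained ((starGraph (0 : Fin 4)).blowup r)) := by
  classical
  have := hG.nonempty
  by_cases hP : ∃ h e g, G.Adj h e ∧ G.Adj h g ∧ e ≠ g ∧ ¬ G.Adj e g
  · obtain ⟨h, e, g, he, hg, hne, heg⟩ := hP
    set w := G.weight (-1 : F) with hw
    have hd : ∀ v, w v v = -1 := weight_self G _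
    have formula := D.eq_of_path_three (weight_comm G _) hd (weight_of_adj he) (weight_of_adj hg)
      (weight_of_not_adj hne heg)
    have key : ∀ x y, x ≠ y → (w x y = -1 ↔ G.Adj x y) := fun x y => weight_eq_neg_one_iff
    by_cases h2 : (2 : F) = 0
    · right
      -- If `w h x = 0`, the formula at `(x, x)` reads `-1 = 2 * w e x * w g x`, impossible in
      -- characteristic 2. So `h` dominates, and the entries at `e` and `g` select the apex or one
      -- of three leaves.
      have types : ∀ x, w h x = -1 ∧ (w e x = 0 ∨ w e x = -1) ∧ (w g x = 0 ∨ w g x = -1) := by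
        intro x
        refine ⟨?_, weight_neg_one_eq_or G e x, weight_neg_one_eq_or G g x⟩
        rcases weight_neg_one_eq_or (F := F) G h x with hx | hx
        · have := formula x x
          rw [hd] at this
          rw [← hw] at hx
          simp only [hx] at this
          exact of_one_eq_zero F (by linear_combination -this - w e x * w g x * h2)
        · exact hx
      refine isIndContained_blowup (fun v => if w e v = -1 then (if w g v = -1 then 0 else 1)
        else (if w g v = -1 then 2 else 3)) fun x y hxy => ?_
      rw [← key x y hxy]
      have f := formula x y
      obtain ⟨a, b, c⟩ := types x
      obtain ⟨a', b', c'⟩ := types y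
      have n1 : ¬ (0 : F) = -1 := by simp [eq_comm]
      rcases b with b | b <;> rcases c with c | c <;> rcases b' with b' | b' <;>
        rcases c' with c' | c' <;> simp only [a, b, c, a', b', c', n1, if_true, if_false] at f ⊢ <;>
        first
          | exact iff_of_true (by linear_combination f) (by decide)
          | exact iff_of_true (by linear_combination f + h2) (by decide)
          | exact iff_of_false (by rw [f]; norm_num) (by decide)
    · left
      -- The diagonal case of the formula leaves the classes of `h`, `e`, `g` and, only in
      -- characteristic 3, a fourth one opposite to `h`.
      have types : ∀ x, (w h x = -1 ∧ w e x = -1 ∧ w g x = -1) ∨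
          (w h x = -1 ∧ w e x = -1 ∧ w g x = 0) ∨ (w h x = -1 ∧ w e x = 0 ∧ w g x = -1) ∨
          (w h x = 0 ∧ w e x = -1 ∧ w g x = -1 ∧ (3 : F) = 0) := by
        intro x
        have f := formula x x
        rw [hd] at f
        rcases weight_neg_one_eq_or (F := F) G h x with a | a <;>
          rcases weight_neg_one_eq_or (F := F) G e x with b | b <;>
          rcases weight_neg_one_eq_or (F := F) G g x with c | c <;> rw [← hw] at a b c <;>
          simp only [a, b, c] at f
        · exact of_one_eq_zero F (by linear_combination -f)
        · exact of_one_eq_zero F (by linear_combination -f)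
        · exact of_one_eq_zero F (by linear_combination -f)
        · exact Or.inr (Or.inr (Or.inr ⟨a, b, c, by linear_combination -f⟩))
        · exact absurd (by linear_combination -f) h2
        · exact Or.inr (Or.inr (Or.inl ⟨a, b, c⟩))
        · exact Or.inr (Or.inl ⟨a, b, c⟩)
        · exact Or.inl ⟨a, b, c⟩
      refine isIndContained_blowup (fun v => if w h v = 0 then 2 else if w e v = 0 then 3 else
        if w g v = 0 then 1 else 0) fun x y hxy => ?_
      rw [← key x y hxy]
      have f := formula x y
      have n1 : ¬ (-1 : F) = 0 := by simp
      rcases types x with ⟨a, b, c⟩ | ⟨a, b, c⟩ | ⟨a, b, c⟩ | ⟨a, b, c, h3⟩ <;>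
        rcases types y with ⟨a', b', c'⟩ | ⟨a', b', c'⟩ | ⟨a', b', c'⟩ | ⟨a', b', c', h3'⟩ <;>
        simp only [a, b, c, a', b', c', n1, if_true, if_false] at f ⊢ <;>
        first
          | exact iff_of_true (by linear_combination f) (by decide)
          | exact iff_of_true (by linear_combination f + h3) (by decide)
          | exact iff_of_false (by rw [f]; norm_num) (by decide)
  -- Without an induced path on three vertices a connected graph is complete: one clique, one
  -- colour.
  · left
    push Not at hP
    have hadj : ∀ u v, G.Reachable u v → u ≠ v → G.Adj u v := by
      rintro u v ⟨p⟩
      induction p with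
      | nil => exact fun h => absurd rfl h
      | @cons u u' v ha _ ih =>
        intro huv
        by_cases h : u' = v
        · exact h ▸ ha
        · exact hP u' u v ha.symm (ih h) huv
    refine isIndContained_blowup (fun _ => 0) fun x y hxy => ?_
    simp [hadj x y (hG.preconnected x y) hxy]

/-- In `K_5` the minor whose rows and columns share exactly three vertices is `-(τ + 1) ^ 3`. -/
theorem eq_neg_one_of_pairwise_adj (D : MinorsVanish (G.weight τ)) {f : Fin 5 → V}
    (hf : ∀ i j, i ≠ j → G.Adj (f i) (f j)) : τ = -1 := by
  have h1 := D (f 0) (f 1) (f 2) (f 3) (f 0) (f 1) (f 2) (f 4)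
  have e : ∀ i j, i ≠ j → G.weight τ (f i) (f j) = -1 := fun i j hij => weight_of_adj (hf i j hij)
  simp (disch := decide) only [weight_self, e] at h1
  have : (τ + 1) ^ 3 = 0 := by linear_combination -h1
  exact eq_neg_of_add_eq_zero_left (pow_eq_zero_iff (by norm_num) |>.mp this)

theorem eq_neg_one_or_forall_of_paw (hP : ∀ a b c d, ¬ G.IsInducedPath a b c d)
    (D : MinorsVanish (G.weight τ)) {h e f g : V} (he : G.Adj h e) (hf : G.Adj h f)
    (hg : G.Adj h g) (hef : G.Adj e f) (heg : ¬ G.Adj e g) (hfg : ¬ G.Adj f g) (neg : e ≠ g)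
    (nfg : f ≠ g) : τ = -1 ∨ ∀ x, x = h ∨ x = e ∨ x = f ∨ x = g := by
  by_contra! hcon
  obtain ⟨hτ, x, xh, xe, xf, xg⟩ := hcon
  have := paw_neighbor_types D (weight_comm G τ) (weight_self G τ) (weight_of_adj he)
    (weight_of_adj hf) (weight_of_adj hg) (weight_of_adj hef) (weight_of_not_adj neg heg)
    (weight_of_not_adj nfg hfg) (weight_eq_zero_or xh.symm) (weight_eq_zero_or xe.symm)
    (weight_eq_zero_or xf.symm) (weight_eq_zero_or xg.symm)
  simp only [weight_eq_zero_iff xh.symm, weight_eq_zero_iff xe.symm, weight_eq_zero_iff xf.symm,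
    weight_eq_zero_iff xg.symm, weight_eq_neg_one_iff xh.symm, weight_eq_neg_one_iff xe.symm,
    weight_eq_neg_one_iff xf.symm, weight_eq_neg_one_iff xg.symm] at this
  rcases this with h1 | ⟨hx, ex, fx, gx⟩ | ⟨hx, ex, fx, gx⟩
  · exact hτ h1
  · exact hP f e x g ⟨hef.symm, ex, gx.symm, fx, heg, hfg⟩
  · exact hP e f x g ⟨hef, fx, gx.symm, ex, hfg, heg⟩

end Weighted

end SimpleGraph

/-! ### The classification -/

namespace SimpleGraph

theorem isIndContained_of_minorsVanish {V F : Type*} [Fintype V] [Field F] {G : SimpleGraph V}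
    (hG : G.Connected) {τ : F} (D : MinorsVanish (G.weight τ)) :
    G.IsIndContained (cycleGraph 5) ∨
      G.IsIndContained (boxProd (completeGraph (Fin 3)) (completeGraph (Fin 2))) ∨
      (∃ s : Fin 4 → ℕ, (∀ i, 0 < s i) ∧
        G.IsIndContained (completeMultipartiteGraph fun i => Fin (s i))) ∨
      (∃ r : Fin 4 → ℤ, (∀ i, r i < 0) ∧ G.IsIndContained ((cycleGraph 4).blowup r)) ∨
      (∃ r : Fin 4 → ℤ, (∀ i, r i < 0) ∧ G.IsIndContained ((starGraph (0 : Fin 4)).blowup r)) := by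
  classical
  have := hG.nonempty
  by_cases hP : ∃ a b c d, G.IsInducedPath a b c d
  · obtain ⟨a, b, c, d, h⟩ := hP
    exact (h.isIndContained D).imp_right Or.inl
  push Not at hP
  refine Or.inr (Or.inr ?_)
  by_cases hτ : τ = -1
  · subst hτ
    exact Or.inr (isIndContained_of_minorsVanish_neg_one hG D)
  by_cases hm : G.IsCompleteMultipartite
  · rcases hm.isIndContained_or_exists_pairwise_adj 4 with h | ⟨f, hf⟩
    · exact Or.inl h
    · exact absurd (eq_neg_one_of_pairwise_adj D hf) hτ
  -- Failure of transitivity of nonadjacency gives an edge `e f` with `g` adjacent to neither end; a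
  -- common neighbour `h` of `g` and `e` then completes a paw.
  obtain ⟨g, e, f, hgef⟩ := exists_isPathGraph3Compl_of_not_isCompleteMultipartite hm
  obtain ⟨h, hgh, hhe⟩ := ((Reachable.exists_common_neighbor hP
    (hG.preconnected g e)).resolve_left hgef.ne_fst).resolve_left hgef.not_adj_fst
  have hef := hgef.adj
  have heg : ¬ G.Adj e g := fun h => hgef.not_adj_fst h.symm
  have hfg : ¬ G.Adj f g := fun h => hgef.not_adj_snd h.symm
  have hhf : G.Adj h f := by
    by_contra hn
    exact hP g h e f ⟨hgh, hhe, hef, hgef.not_adj_fst, hn, hgef.not_adj_snd⟩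
  have all := (eq_neg_one_or_forall_of_paw hP D hhe hhf hgh.symm hef heg hfg
    hgef.ne_fst.symm hgef.ne_snd.symm).resolve_left hτ
  -- The paw is a star blow-up: apex `h`, one leaf `g`, one leaf replaced by the clique `e f`.
  refine Or.inr (Or.inr (isIndContained_blowup
    (fun v => if v = h then 0 else if v = g then 2 else 1) fun x y hxy => ?_))
  have eh := hhe.ne'
  have fh := hhf.ne'
  have gh := hgh.ne
  have eg := hgef.ne_fst.symm
  have fg := hgef.ne_snd.symm
  rcases all x with rfl | rfl | rfl | rfl <;> rcases all y with rfl | rfl | rfl | rfl <;>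
    first
      | exact absurd rfl hxy
      | simp [eh, fh, gh, eg, fg, hhe, hhe.symm, hhf, hhf.symm, hgh, hgh.symm, hef, hef.symm, heg,
          hfg, hgef.not_adj_fst, hgef.not_adj_snd]

end SimpleGraph

theorem mainTheorem1 {V : Type*} [Fintype V] [DecidableEq V] (G : SimpleGraph V)
    [DecidableRel G.Adj] (hG : G.Connected) :
    G.numTrivialCharacteristicIdeals ≤ 3 ↔
      G.IsIndContained (SimpleGraph.cycleGraph 5) ∨
      G.IsIndContained
        (SimpleGraph.boxProd (SimpleGraph.completeGraph (Fin 3))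
          (SimpleGraph.completeGraph (Fin 2))) ∨
      (∃ s : Fin 4 → ℕ, (∀ i, 0 < s i) ∧
        G.IsIndContained (SimpleGraph.completeMultipartiteGraph fun i => Fin (s i))) ∨
      (∃ r : Fin 4 → ℤ, (∀ i, r i < 0) ∧
        G.IsIndContained ((SimpleGraph.cycleGraph 4).blowup r)) ∨
      (∃ r : Fin 4 → ℤ, (∀ i, r i < 0) ∧
        G.IsIndContained ((SimpleGraph.starGraph (0 : Fin 4)).blowup r)) := by
  rw [SimpleGraph.numTrivialCharacteristicIdeals_le_iff]
  constructor
  · intro h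
    obtain ⟨F, _, τ, D⟩ := G.exists_minorsVanish h
    exact SimpleGraph.isIndContained_of_minorsVanish hG D
  · rintro (h | h | ⟨s, -, h⟩ | ⟨r, hr, h⟩ | ⟨r, hr, h⟩)
    · exact SimpleGraph.characteristicIdeal_ne_top_of_cycleGraph_five h
    · exact SimpleGraph.characteristicIdeal_ne_top_of_prism h
    · exact SimpleGraph.characteristicIdeal_ne_top_of_completeMultipartite h
    · exact SimpleGraph.characteristicIdeal_ne_top_of_cycleGraph_four_blowup hr h
    · exact SimpleGraph.characteristicIdeal_ne_top_of_starGraph_blowup hr h
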